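/- \textbf{Setting.} A \emph{cell complex} $K$ in $\mathbb{R}^d$ is a collection of subsets (cells), each homeomorphic to a closed unit ball of some dimension $\le d$, such that the boundary of each cell is a union of lower-dimensional cells (its \emph{faces}) and two different cells meet in a (possibly empty) union of common faces, where a cell counts as a face of itself for this purpose; $K$ is assumed to be locally finite in $\mathbb{R}^d$. A \emph{filter} is a function $f\colon K\to\mathbb{R}$ with $f(\sigma)\le f(\tau)$ whenever $\sigma$ is a face of $\tau$. For a $d$-dimensional lattice $\Lambda\subseteq\mathbb{R}^d$, $K$ is \emph{$\Lambda$-periodic} if $\sigma+u\in K$ for all $\sigma\in K$, $u\in\Lambda$, and $f$ is $\Lambda$-periodic if moreover $f(\sigma+u)=f(\sigma)$. Identifying cells that are translates by vectors of $\Lambda$ gives the quotient complex $K/\Lambda$ on the torus $\mathbb{R}^d/\Lambda$ and the quotient filter $f/\Lambda$; write $(K/\Lambda)_t$ for the union of the cells of $K/\Lambda$ with value at most $t$. \textbf{Periodic merge tree.} Let $\mathcal{S}=\{(x,s)\in (\mathbb{R}^d/\Lambda)\times\mathbb{R} : x\in (K/\Lambda)_s\}$, and let $(x,s)\sim(y,t)$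 if $s=t$ and $x,y$ lie in the same connected component of $(K/\Lambda)_s$. The periodic merge tree $M(f,\Lambda)$ is $\mathcal{S}/{\sim}$ with the quotient topology; its points are the connected components $C$ of the sublevel sets. It carries the height function $h$ induced by $(x,s)\mapsto s$, and the frequency function $F$ that maps $C$ to its \emph{shadow monomial} $$F(C)=\frac{\mathrm{vol}_p(\Lambda_C)}{\mathrm{vol}_d(\Lambda)}\,\nu_{d-p}\,R^{d-p},$$ where $\Lambda_C$ is the lattice of all $u\in\Lambda$ with $c+u=c$ for every connected component $c$ of the preimage of $C$ in $\mathbb{R}^d$, $p=\dim\Lambda_C$, $\mathrm{vol}$ is the volume of a unit cell (in the span of the lattice), and $\nu_q$ is the volume of the unit ball in $\mathbb{R}^q$. A point $B$ \emph{covers} $A$ if $h(A)\le h(B)$ and $A\subseteq B$ as sets; $M_C$ is the subtree of all points covered by $C$, with the inherited data. Monomials are ordered first by exponent, then by coefficient. \textbf{Interleaving distance.} For such trees (or subtrees) $M,N$ with height functions $h_M,h_N$ and frequency functions $F_M,F_N$, and for $\varepsilon\ge 0$, continuous maps $\varphi\colon M\to N$ and $\psi\colon N\to M$ are $\varepsilon$-compatible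 if $h_N\circ\varphi=h_M+\varepsilon$, $h_M\circ\psi=h_N+\varepsilon$, $\psi\varphi(C)$ covers $C$ and $\varphi\psi(C')$ covers $C'$, $F_N(\varphi(C))\le F_M(C)$ and $F_M(\psi(C'))\le F_N(C')$, for all $C\in M$ and $C'\in N$. The distance $I(M,N)$ is the infimum of the $\varepsilon\geq 0$ that admit $\varepsilon$-compatible maps ($\infty$ if there are none). \textbf{Lemma (Splintering from Sublattice).} Let $\Lambda\subseteq\mathbb{R}^d$ be a $d$-dimensional lattice, $f\colon K\to\mathbb{R}$ a $\Lambda$-periodic filter on a $\Lambda$-periodic locally finite cell complex $K$ in $\mathbb{R}^d$, and $\Lambda'\subseteq\Lambda$ a $d$-dimensional sublattice. Then $M'=M(f,\Lambda')$ \emph{splinters} $M=M(f,\Lambda)$; that is, there is a continuous surjection $\omega\colon M'\to M$ such that (i) $\omega$ preserves height: $h(\omega(A))=h'(A)$ for all $A\in M'$; (ii) $\omega$ splits subtrees evenly: for every $C\in M$ the preimage $\omega^{-1}(C)$ is finite, and for all $A,B\in\omega^{-1}(C)$ we have $I(M'_A,M'_B)=0$, $\omega$ maps $M'_A$ (and likewise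 $M'_B$) onto $M_C$, and $F'(A)=F'(B)=F(C)/\#\omega^{-1}(C)$. -/

import Mathlib

open scoped NNReal ENNReal

noncomputable section

namespace PeriodicMerge

/-- Euclidean space of dimension `d`. -/
abbrev E (d : ℕ) : Type := EuclideanSpace ℝ (Fin d)

/-- The closed unit ball of dimension `n`. -/
abbrev UnitBall (n : ℕ) : Type := Metric.closedBall (0 : E n) 1

/-- The translate `A + u`. -/
def translate {d : ℕ} (u : E d) (A : Set (E d)) : Set (E d) := (fun x => x + u) '' A

theorem translate_zero {d : ℕ} (A : Set (E d)) : translate 0 A = A := by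
  simp [translate]

theorem translate_translate {d : ℕ} (u v : E d) (A : Set (E d)) :
    translate v (translate u A) = translate (u + v) A := by
  unfold translate
  rw [Set.image_image]
  simp only [add_assoc]

/-! ### Cell complexes and filters -/

/-- The boundary of a cell: the image of the unit sphere under a homeomorphism from the ball. -/
def cellBoundary {d n : ℕ} {σ : Set (E d)} (h : UnitBall n ≃ₜ σ) : Set (E d) :=
  (fun y : UnitBall n => (h y : E d)) '' {y | ‖(y : E n)‖ = 1}

/-- A locally finite cell complex in `ℝ^d`. Its cells are closed topological balls, the boundary
of a cell is a union of lower-dimensional cells, and two different cells meet in a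
(possibly empty) union of common faces, where a cell is an (improper) face of itself. -/
structure CellComplex (d : ℕ) where
  /-- The cells, as closed subsets of `ℝ^d`. -/
  cells : Set (Set (E d))
  /-- The dimension of a cell. -/
  dim : cells → ℕ
  dim_le : ∀ σ, dim σ ≤ d
  /-- Each cell is homeomorphic to a closed ball. -/
  chart : ∀ σ : cells, UnitBall (dim σ) ≃ₜ (σ : Set (E d))
  boundary_eq : ∀ τ : cells, cellBoundary (chart τ) =
    ⋃ σ ∈ {σ : cells | dim σ < dim τ ∧ (σ : Set (E d)) ⊆ cellBoundary (chart τ)}, (σ : Set (E d))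
  inter_eq : ∀ σ τ : cells, σ ≠ τ → (σ : Set (E d)) ∩ (τ : Set (E d)) =
    ⋃ ρ ∈ {ρ : cells | (ρ = σ ∨ (ρ : Set (E d)) ⊆ cellBoundary (chart σ)) ∧
      (ρ = τ ∨ (ρ : Set (E d)) ⊆ cellBoundary (chart τ))}, (ρ : Set (E d))
  locallyFinite : LocallyFinite fun σ : cells => (σ : Set (E d))

/-- `σ` is a (proper) face of `τ`. -/
def CellComplex.IsFace {d : ℕ} (K : CellComplex d) (σ τ : K.cells) : Prop :=
  K.dim σ < K.dim τ ∧ (σ : Set (E d)) ⊆ cellBoundary (K.chart τ)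

/-- A filter of `K`: a real function on the cells that is monotone along the face relation. -/
structure CellFilter {d : ℕ} (K : CellComplex d) where
  /-- The value of a cell. -/
  val : K.cells → ℝ
  mono : ∀ σ τ, K.IsFace σ τ → val σ ≤ val τ

/-- `K` is `Λ`-periodic. -/
def CellComplex.IsPeriodic {d : ℕ} (K : CellComplex d) (Λ : Submodule ℤ (E d)) : Prop :=
  ∀ σ ∈ K.cells, ∀ u ∈ Λ, translate u σ ∈ K.cells

/-- `f` is `Λ`-periodic. -/
def CellFilter.IsPeriodic {d : ℕ} {K : CellComplex d} (f : CellFilter K)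
    (Λ : Submodule ℤ (E d)) : Prop :=
  ∀ σ τ : K.cells, ∀ u ∈ Λ, (τ : Set (E d)) = translate u σ → f.val σ = f.val τ

theorem CellComplex.IsPeriodic.mono {d : ℕ} {K : CellComplex d} {Λ Λ' : Submodule ℤ (E d)}
    (hK : K.IsPeriodic Λ) (h : Λ' ≤ Λ) : K.IsPeriodic Λ' :=
  fun σ hσ u hu => hK σ hσ u (h hu)

theorem CellFilter.IsPeriodic.mono {d : ℕ} {K : CellComplex d} {f : CellFilter K}
    {Λ Λ' : Submodule ℤ (E d)} (hf : f.IsPeriodic Λ) (h : Λ' ≤ Λ) : f.IsPeriodic Λ' :=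
  fun σ τ u hu => hf σ τ u (h hu)

/-! ### The quotient complex on the torus -/

/-- The torus `ℝ^d / Λ` (with the quotient topology). -/
abbrev Torus {d : ℕ} (Λ : Submodule ℤ (E d)) : Type := E d ⧸ Λ

/-- Two cells are identified if they are translates by a vector of `Λ`. -/
def cellSetoid {d : ℕ} (K : CellComplex d) (Λ : Submodule ℤ (E d)) : Setoid K.cells where
  r σ τ := ∃ u ∈ Λ, (τ : Set (E d)) = translate u σ
  iseqv :=
    { refl := fun σ => ⟨0, Λ.zero_mem, (translate_zero _).symm⟩
      symm := by
        rintro σ τ ⟨u, hu, h⟩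
        exact ⟨-u, Λ.neg_mem hu, by rw [h, translate_translate, add_neg_cancel, translate_zero]⟩
      trans := by
        rintro σ τ ρ ⟨u, hu, h⟩ ⟨v, hv, h'⟩
        exact ⟨u + v, Λ.add_mem hu hv, by rw [h', h, translate_translate]⟩ }

/-- The cells of the quotient complex `K/Λ`. -/
def QuotientCell {d : ℕ} (K : CellComplex d) (Λ : Submodule ℤ (E d)) : Type :=
  Quotient (cellSetoid K Λ)

/-- The subset of the torus covered by a cell of `K/Λ`. -/
def QuotientCell.carrier {d : ℕ} {K : CellComplex d} {Λ : Submodule ℤ (E d)}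
    (c : QuotientCell K Λ) : Set (Torus Λ) :=
  Quotient.lift (s := cellSetoid K Λ)
    (fun σ : K.cells => (fun x : E d => (Submodule.Quotient.mk x : Torus Λ)) '' (σ : Set (E d)))
    (by
      rintro σ τ ⟨u, hu, h⟩
      simp only [h, translate, Set.image_image]
      refine Set.image_congr fun x _ => ?_
      rw [Submodule.Quotient.mk_add, (Submodule.Quotient.mk_eq_zero Λ).2 hu, add_zero]) c

/-- The quotient filter `f/Λ : K/Λ → ℝ`. -/
def CellFilter.quotient {d : ℕ} {K : CellComplex d} (f : CellFilter K) {Λ : Submodule ℤ (E d)}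
    (hf : f.IsPeriodic Λ) : QuotientCell K Λ → ℝ :=
  Quotient.lift (s := cellSetoid K Λ) f.val (by
    rintro σ τ ⟨u, hu, h⟩
    exact hf σ τ u hu h)

/-- The underlying space of the sublevel set `(K/Λ)_t` of the quotient filter. -/
def CellFilter.quotientSublevel {d : ℕ} {K : CellComplex d} (f : CellFilter K)
    {Λ : Submodule ℤ (E d)} (hf : f.IsPeriodic Λ) (t : ℝ) : Set (Torus Λ) :=
  ⋃ c ∈ {c : QuotientCell K Λ | f.quotient hf c ≤ t}, c.carrier

/-! ### Merge trees -/

/-- The sublevel space `{(x, s) | x ∈ S s}`, with the topology inherited from `X × ℝ`. -/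
abbrev SublevelSpace {X : Type} (S : ℝ → Set X) : Type := {p : X × ℝ // p.1 ∈ S p.2}

/-- `(x, s) ∼ (y, t)` if `s = t` and `x`, `y` lie in the same connected component of `S s`. -/
def mergeSetoid {X : Type} [TopologicalSpace X] (S : ℝ → Set X) : Setoid (SublevelSpace S) where
  r p q := p.1.2 = q.1.2 ∧
    connectedComponentIn (S p.1.2) p.1.1 = connectedComponentIn (S q.1.2) q.1.1
  iseqv :=
    { refl := fun _ => ⟨rfl, rfl⟩
      symm := fun h => ⟨h.1.symm, h.2.symm⟩
      trans := fun h h' => ⟨h.1.trans h'.1, h.2.trans h'.2⟩ }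

/-- The merge tree of a family of sublevel sets. -/
def MergeTree {X : Type} [TopologicalSpace X] (S : ℝ → Set X) : Type := Quotient (mergeSetoid S)

instance {X : Type} [TopologicalSpace X] (S : ℝ → Set X) : TopologicalSpace (MergeTree S) :=
  inferInstanceAs (TopologicalSpace (Quotient (mergeSetoid S)))

/-- The height function of a merge tree. -/
def MergeTree.height {X : Type} [TopologicalSpace X] {S : ℝ → Set X} : MergeTree S → ℝ :=
  Quotient.lift (s := mergeSetoid S) (fun p => p.1.2) (fun _ _ h => h.1)

/-- The connected component that a point of a merge tree represents. -/
def MergeTree.component {X : Type} [TopologicalSpace X] {S : ℝ → Set X} : MergeTree S → Set X :=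
  Quotient.lift (s := mergeSetoid S) (fun p => connectedComponentIn (S p.1.2) p.1.1)
    (fun _ _ h => h.2)

/-! ### Shadow monomials -/

/-- A monomial `coeff * R ^ exponent` in the variable `R`. -/
@[ext]
structure RMonomial where
  /-- The coefficient. -/
  coeff : ℝ
  /-- The exponent. -/
  exponent : ℕ

/-- Monomials are compared by exponent, and by coefficient if the exponents agree. -/
instance : LE RMonomial where
  le m n := m.exponent < n.exponent ∨ (m.exponent = n.exponent ∧ m.coeff ≤ n.coeff)

/-- Division of a monomial by a natural number. -/
def RMonomial.divNat (m : RMonomial) (k : ℕ) : RMonomial := ⟨m.coeff / k, m.exponent⟩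

/-- The volume of the unit ball in `ℝ^q`. -/
def unitBallVolume (q : ℕ) : ℝ := (MeasureTheory.volume (Metric.ball (0 : E q) 1)).toReal

/-- The volume of a unit cell of a lattice `L` of arbitrary dimension, measured by the
Lebesgue measure of the Euclidean space spanned by `L`. -/
def latticeVolume {d : ℕ} (L : Submodule ℤ (E d)) : ℝ :=
  ZLattice.covolume
    (ZLattice.comap ℝ L (Submodule.span ℝ (L : Set (E d))).subtype) MeasureTheory.volume

/-- The preimage of a subset of the torus in `ℝ^d`. -/
def lift {d : ℕ} {Λ : Submodule ℤ (E d)} (C : Set (Torus Λ)) : Set (E d) :=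
  (fun x : E d => (Submodule.Quotient.mk x : Torus Λ)) ⁻¹' C

/-- The shadows of `C`: the connected components of its preimage in `ℝ^d`. -/
def shadows {d : ℕ} {Λ : Submodule ℤ (E d)} (C : Set (Torus Λ)) : Set (Set (E d)) :=
  (fun x => connectedComponentIn (lift C) x) '' lift C

/-- The periodicity lattice of `C`: the vectors of `Λ` that keep every shadow invariant. -/
def periodicityLattice {d : ℕ} {Λ : Submodule ℤ (E d)} (C : Set (Torus Λ)) :
    Submodule ℤ (E d) :=
  AddSubgroup.toIntSubmodule
    { carrier := {u | u ∈ Λ ∧ ∀ c ∈ shadows C, translate u c = c}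
      zero_mem' := ⟨Λ.zero_mem, fun c _ => translate_zero c⟩
      add_mem' := by
        rintro u v ⟨hu, hu'⟩ ⟨hv, hv'⟩
        refine ⟨Λ.add_mem hu hv, fun c hc => ?_⟩
        rw [← translate_translate, hu' c hc, hv' c hc]
      neg_mem' := by
        rintro u ⟨hu, hu'⟩
        refine ⟨Λ.neg_mem hu, fun c hc => ?_⟩
        have h : translate (-u) (translate u c) = c := by
          rw [translate_translate, add_neg_cancel, translate_zero]
        rwa [hu' c hc] at h }

/-- The shadow monomial of `C`: with `p` the dimension of the periodicity lattice `Λ_C`, it is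
`vol_p(Λ_C) / vol_d(Λ) * ν_{d-p} * R^{d-p}`. -/
def shadowMonomial {d : ℕ} {Λ : Submodule ℤ (E d)} (C : Set (Torus Λ)) : RMonomial where
  coeff := latticeVolume (periodicityLattice C) / latticeVolume Λ *
    unitBallVolume (d - Module.finrank ℤ (periodicityLattice C))
  exponent := d - Module.finrank ℤ (periodicityLattice C)

/-! ### Periodic merge trees, interleaving distance, splintering -/

/-- A tree decorated with a height function and a frequency function, whose points represent
subsets (components) of a space `X`. -/
structure DecoratedTree (X : Type) where
  /-- The points of the tree. -/
  Point : Type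
  /-- The topology of the tree. -/
  top : TopologicalSpace Point
  /-- The component that a point represents. -/
  component : Point → Set X
  /-- The height function. -/
  height : Point → ℝ
  /-- The frequency function. -/
  frequency : Point → RMonomial

instance {X : Type} (M : DecoratedTree X) : TopologicalSpace M.Point := M.top

/-- `b` covers `a`. -/
def DecoratedTree.Covers {X : Type} (M : DecoratedTree X) (b a : M.Point) : Prop :=
  M.height a ≤ M.height b ∧ M.component a ⊆ M.component b

/-- The subtree with topmost point `c`: all points covered by `c`, with the inherited data. -/
def DecoratedTree.subtree {X : Type} (M : DecoratedTree X) (c : M.Point) : DecoratedTree X where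
  Point := {a : M.Point // M.Covers c a}
  top := inferInstance
  component a := M.component a
  height a := M.height a
  frequency a := M.frequency a

/-- The periodic merge tree of `f` with respect to `Λ`: the merge tree of the quotient filter
`f/Λ`, with its height function and the shadow monomials. -/
def periodicMergeTree {d : ℕ} {K : CellComplex d} (f : CellFilter K) (Λ : Submodule ℤ (E d))
    (hf : f.IsPeriodic Λ) : DecoratedTree (Torus Λ) where
  Point := MergeTree (f.quotientSublevel hf)
  top := inferInstance
  component := MergeTree.component
  height := MergeTree.height
  frequency C := shadowMonomial C.component

/-- `φ` and `ψ` are `ε`-compatible maps between the trees `M` and `N`. -/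
structure Compatible {X Y : Type} (M : DecoratedTree X) (N : DecoratedTree Y) (ε : ℝ≥0)
    (φ : M.Point → N.Point) (ψ : N.Point → M.Point) : Prop where
  continuous_left : Continuous φ
  continuous_right : Continuous ψ
  height_left : ∀ c, N.height (φ c) = M.height c + ε
  height_right : ∀ c, M.height (ψ c) = N.height c + ε
  covers_left : ∀ c, M.Covers (ψ (φ c)) c
  covers_right : ∀ c, N.Covers (φ (ψ c)) c
  frequency_left : ∀ c, N.frequency (φ c) ≤ M.frequency c
  frequency_right : ∀ c, M.frequency (ψ c) ≤ N.frequency c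

/-- The interleaving distance: the infimum of the `ε ≥ 0` that admit `ε`-compatible maps
(`∞` if there is no such `ε`). -/
def interleavingDist {X Y : Type} (M : DecoratedTree X) (N : DecoratedTree Y) : ℝ≥0∞ :=
  ⨅ (ε : ℝ≥0) (_ : ∃ φ ψ, Compatible M N ε φ ψ), (ε : ℝ≥0∞)

/-- The map `ω` is a splintering of the tree `M` by the tree `M'`. -/
structure IsSplintering {X X' : Type} (M' : DecoratedTree X') (M : DecoratedTree X)
    (ω : M'.Point → M.Point) : Prop where
  continuous : Continuous ω
  surjective : Function.Surjective ω
  height_eq : ∀ a, M.height (ω a) = M'.height a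
  finite_fiber : ∀ c, (ω ⁻¹' {c}).Finite
  subtree_eq : ∀ c, ∀ a ∈ ω ⁻¹' {c}, ∀ b ∈ ω ⁻¹' {c},
    interleavingDist (M'.subtree a) (M'.subtree b) = 0
  subtree_surj : ∀ c, ∀ a ∈ ω ⁻¹' {c}, ω '' {b | M'.Covers a b} = {b | M.Covers c b}
  frequency_eq : ∀ c, ∀ a ∈ ω ⁻¹' {c},
    M'.frequency a = (M.frequency c).divNat (ω ⁻¹' {c}).ncard

/-- `M'` splinters `M`. -/
def Splinters {X X' : Type} (M' : DecoratedTree X') (M : DecoratedTree X) : Prop :=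
  ∃ ω : M'.Point → M.Point, IsSplintering M' M ω

end PeriodicMerge

end

open PeriodicMerge

noncomputable section

namespace PeriodicMerge

/-! ### Volumes of lattices -/

/-! Both trees are quotients of the same object, the components of the sublevel sets of `f` in
`ℝ^d`. By `CellFilter.component_quotientSublevel`, every component on the torus is the projection of
a component upstairs; by `treePoint_eq_iff`, two components at the same height give the same point
exactly when they differ by a translation in the lattice. Hence `Λ` acts on the tree of `Λ'`, and
the fibers of the natural map `ω` are the orbits (`splinterMap_eq_iff`). The topological input is
that local finiteness makes components relatively open in their sublevel set.

Translations preserve height, inclusion and frequency, so subtrees over the same point are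
isomorphic and have distance 0.

The frequency formula is orbit-stabilizer plus the second isomorphism theorem. If `Λ_C` is the
periodicity lattice of `C` over `Λ`, then a point above `C` has stabilizer `Λ' + Λ_C` in `Λ`, so the
fiber has `[Λ : Λ' + Λ_C]` points. Its periodicity lattice over `Λ'` is `Λ' ∩ Λ_C`, and
`latticeVolume_inf_div` shows that its volume relative to `Λ'` is smaller by precisely this index.
-/

theorem discreteTopology_of_le {d : ℕ} {L' L : Submodule ℤ (E d)} [hL : DiscreteTopology L]
    (h : L' ≤ L) : DiscreteTopology L' :=
  DiscreteTopology.of_continuous_injective (f := Submodule.inclusion h)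
    (continuous_inclusion h) (Submodule.inclusion_injective h)

/-- Covolumes of a lattice and a sublattice with the same span `W`, measured in `W`. -/
theorem covolume_comap_subtype {d : ℕ} {L' L : Submodule ℤ (E d)} [DiscreteTopology L]
    (h : L' ≤ L) (W : Submodule ℝ (E d)) (hW : Submodule.span ℝ (L : Set (E d)) = W)
    (hW' : Submodule.span ℝ (L' : Set (E d)) = W) :
    0 < ZLattice.covolume (ZLattice.comap ℝ L W.subtype) MeasureTheory.volume ∧
    ZLattice.covolume (ZLattice.comap ℝ L' W.subtype) MeasureTheory.volume =
      L'.toAddSubgroup.relIndex L.toAddSubgroup *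
        ZLattice.covolume (ZLattice.comap ℝ L W.subtype) MeasureTheory.volume := by
  have := discreteTopology_of_le h
  have hr : ∀ N : Submodule ℤ (E d), Submodule.span ℝ (N : Set (E d)) = W →
      Submodule.span ℝ (ZLattice.comap ℝ N W.subtype : Set W) = ⊤ := by
    intro N hN
    rw [← (Submodule.map_injective_of_injective W.injective_subtype).eq_iff, Submodule.map_span,
      Submodule.map_top, Submodule.range_subtype, ZLattice.coe_comap,
      Set.image_preimage_eq_of_subset, hN]
    rintro x hx
    exact ⟨⟨x, hN ▸ Submodule.subset_span hx⟩, rfl⟩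
  have d1 : DiscreteTopology (ZLattice.comap ℝ L W.subtype) :=
    ZLattice.comap_discreteTopology ℝ L continuous_subtype_val W.injective_subtype
  have d2 : DiscreteTopology (ZLattice.comap ℝ L' W.subtype) :=
    ZLattice.comap_discreteTopology ℝ L' continuous_subtype_val W.injective_subtype
  have z1 : IsZLattice ℝ (ZLattice.comap ℝ L W.subtype) := ⟨hr L hW⟩
  have z2 : IsZLattice ℝ (ZLattice.comap ℝ L' W.subtype) := ⟨hr L' hW'⟩
  have hpos := ZLattice.covolume_pos (ZLattice.comap ℝ L W.subtype) MeasureTheory.volume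
  refine ⟨hpos, ?_⟩
  have key := ZLattice.covolume_div_covolume_eq_relIndex' (ZLattice.comap ℝ L' W.subtype)
    (ZLattice.comap ℝ L W.subtype) (fun x hx => h hx)
  rw [div_eq_iff hpos.ne'] at key
  rw [key, ZLattice.comap_toAddSubgroup, ZLattice.comap_toAddSubgroup, AddSubgroup.relIndex_comap]
  congr 2
  -- `relIndex_comap` leaves the image of the pullback of `L` in place of `L`; the two agree because
  -- `L` lies in `W`.
  have hL : L.toAddSubgroup ≤ W.subtype.toAddMonoidHom.range := by
    intro x hx
    exact ⟨⟨x, hW ▸ Submodule.subset_span hx⟩, rfl⟩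
  rw [AddSubgroup.map_comap_eq_self hL]

theorem latticeVolume_pos {d : ℕ} (L : Submodule ℤ (E d)) [DiscreteTopology L] :
    0 < latticeVolume L :=
  (covolume_comap_subtype le_rfl _ rfl rfl).1

/-- The volume of a sublattice that spans the same space is the index times the volume. -/
theorem latticeVolume_eq_relIndex_mul {d : ℕ} {L' L : Submodule ℤ (E d)} [DiscreteTopology L]
    (h : L' ≤ L) (hs : Submodule.span ℝ (L' : Set (E d)) = Submodule.span ℝ (L : Set (E d))) :
    latticeVolume L' = L'.toAddSubgroup.relIndex L.toAddSubgroup * latticeVolume L := by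
  -- The ambient space of the covolume is the span itself, so `hs` cannot simply be rewritten; with
  -- `W` a variable, the equation can be eliminated by `rfl`.
  have hW : ∀ W : Submodule ℝ (E d), Submodule.span ℝ (L' : Set (E d)) = W → latticeVolume L' =
      ZLattice.covolume (ZLattice.comap ℝ L' W.subtype) MeasureTheory.volume := by
    rintro _ rfl
    rfl
  exact (hW _ hs).trans (covolume_comap_subtype h _ rfl hs).2

theorem span_eq_of_relIndex_ne_zero {d : ℕ} {L' L : Submodule ℤ (E d)} (h : L' ≤ L)
    (hi : L'.toAddSubgroup.relIndex L.toAddSubgroup ≠ 0) :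
    Submodule.span ℝ (L' : Set (E d)) = Submodule.span ℝ (L : Set (E d)) := by
  refine le_antisymm (Submodule.span_mono h) (Submodule.span_le.2 fun x hx => ?_)
  obtain ⟨n, hn, -, hnx⟩ := AddSubgroup.exists_nsmul_mem_of_relIndex_ne_zero hi
    (show x ∈ L.toAddSubgroup from hx)
  have hx' : n • x ∈ Submodule.span ℝ (L' : Set (E d)) := Submodule.subset_span hnx.1
  have : x = (n : ℝ)⁻¹ • (n • x) := by
    rw [← Nat.cast_smul_eq_nsmul ℝ n x, inv_smul_smul₀ (Nat.cast_ne_zero.2 hn.ne')]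
  rw [this]
  exact Submodule.smul_mem _ _ hx'

/-- In a discrete subgroup, integral independence implies real independence. This turns equality of
spans into equality of the exponents of shadow monomials. -/
theorem finrank_int_eq_finrank_span {d : ℕ} (L : Submodule ℤ (E d)) [DiscreteTopology L] :
    Module.finrank ℤ L = Module.finrank ℝ (Submodule.span ℝ (L : Set (E d))) := by
  have := Real.finrank_eq_int_finrank_of_discrete (s := (L : Set (E d)))
    (by rwa [Submodule.span_eq])
  rw [Set.finrank, Set.finrank, Submodule.span_eq] at this
  exact this.symm

/-- An infinite index counts as 0, and the volume formula would then give `Λ'` volume 0. -/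
theorem relIndex_ne_zero_of_isZLattice {d : ℕ} {Λ Λ' : Submodule ℤ (E d)}
    [DiscreteTopology Λ] [IsZLattice ℝ Λ] [DiscreteTopology Λ'] [IsZLattice ℝ Λ'] (h : Λ' ≤ Λ) :
    Λ'.toAddSubgroup.relIndex Λ.toAddSubgroup ≠ 0 := by
  intro h0
  have h1 := latticeVolume_eq_relIndex_mul h
    ((IsZLattice.span_top (K := ℝ) (L := Λ')).trans (IsZLattice.span_top (K := ℝ) (L := Λ)).symm)
  rw [h0, Nat.cast_zero, zero_mul] at h1
  exact (latticeVolume_pos Λ').ne' h1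

/-- Intersecting with a sublattice `Λ'` of `Λ` preserves the rank of `L ≤ Λ`, and divides the
relative volume by the index of `Λ' + L` in `Λ`. -/
theorem latticeVolume_inf_div {d : ℕ} {Λ Λ' L : Submodule ℤ (E d)}
    [DiscreteTopology Λ] [IsZLattice ℝ Λ] [DiscreteTopology Λ'] [IsZLattice ℝ Λ'] (h : Λ' ≤ Λ)
    (hL : L ≤ Λ) :
    Module.finrank ℤ (Λ' ⊓ L : Submodule ℤ (E d)) = Module.finrank ℤ L ∧
    latticeVolume (Λ' ⊓ L) / latticeVolume Λ' = latticeVolume L / latticeVolume Λ /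
      ((Λ'.toAddSubgroup ⊔ L.toAddSubgroup).relIndex Λ.toAddSubgroup : ℕ) := by
  have hi := relIndex_ne_zero_of_isZLattice h
  have dL := discreteTopology_of_le hL
  have dI : DiscreteTopology (Λ' ⊓ L : Submodule ℤ (E d)) :=
    discreteTopology_of_le inf_le_right
  have hinf : (Λ' ⊓ L).toAddSubgroup.relIndex L.toAddSubgroup =
      Λ'.toAddSubgroup.relIndex L.toAddSubgroup :=
    AddSubgroup.inf_relIndex_right Λ'.toAddSubgroup L.toAddSubgroup
  have hi' : Λ'.toAddSubgroup.relIndex L.toAddSubgroup ≠ 0 :=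
    fun h0 => hi (AddSubgroup.relIndex_eq_zero_of_le_right hL h0)
  have hs : Submodule.span ℝ ((Λ' ⊓ L : Submodule ℤ (E d)) : Set (E d)) =
      Submodule.span ℝ (L : Set (E d)) :=
    span_eq_of_relIndex_ne_zero inf_le_right (by rwa [hinf])
  refine ⟨by rw [finrank_int_eq_finrank_span, finrank_int_eq_finrank_span, hs], ?_⟩
  -- The tower `Λ' ≤ Λ' + L ≤ Λ` splits `[Λ : Λ']`, and the second isomorphism theorem replaces `[Λ'
  -- + L : Λ']` by `[L : Λ' ∩ L]`, which cancels against the volume of `Λ' ∩ L`.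
  have hmul := AddSubgroup.relIndex_mul_relIndex Λ'.toAddSubgroup
    (Λ'.toAddSubgroup ⊔ L.toAddSubgroup) Λ.toAddSubgroup le_sup_left (sup_le h hL)
  rw [AddSubgroup.relIndex_sup_left] at hmul
  rw [latticeVolume_eq_relIndex_mul inf_le_right hs, hinf,
    latticeVolume_eq_relIndex_mul h (span_eq_of_relIndex_ne_zero h hi), ← hmul]
  have h0 := (latticeVolume_pos Λ).ne'
  rw [← hmul] at hi
  have h1 : (Λ'.toAddSubgroup.relIndex L.toAddSubgroup : ℝ) ≠ 0 := Nat.cast_ne_zero.2 hi'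
  have h2 : ((Λ'.toAddSubgroup ⊔ L.toAddSubgroup).relIndex Λ.toAddSubgroup : ℝ) ≠ 0 :=
    Nat.cast_ne_zero.2 (right_ne_zero_of_mul hi)
  push_cast
  field_simp

/-! ### Sublevel sets and their components -/

/-- The union of the cells of value at most `t`. -/
def CellFilter.sublevel {d : ℕ} {K : CellComplex d} (f : CellFilter K) (t : ℝ) : Set (E d) :=
  ⋃ σ ∈ {σ : K.cells | f.val σ ≤ t}, (σ : Set (E d))

theorem CellFilter.sublevel_mono {d : ℕ} {K : CellComplex d} (f : CellFilter K) {s t : ℝ}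
    (h : s ≤ t) : f.sublevel s ⊆ f.sublevel t :=
  Set.biUnion_subset_biUnion_left fun _ hσ => le_trans hσ h

theorem add_mem_translate_iff {d : ℕ} {u x : E d} {A : Set (E d)} :
    x + u ∈ translate u A ↔ x ∈ A :=
  (add_left_injective u).mem_set_image

theorem mem_translate_iff {d : ℕ} {u x : E d} {A : Set (E d)} :
    x ∈ translate u A ↔ x - u ∈ A := by
  rw [← add_mem_translate_iff (u := u) (x := x - u), sub_add_cancel]

theorem CellFilter.add_mem_sublevel {d : ℕ} {K : CellComplex d} {f : CellFilter K}
    {Λ : Submodule ℤ (E d)} (hK : K.IsPeriodic Λ) (hf : f.IsPeriodic Λ) {t : ℝ} {x u : E d}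
    (hx : x ∈ f.sublevel t) (hu : u ∈ Λ) : x + u ∈ f.sublevel t := by
  simp only [sublevel, Set.mem_iUnion, Set.mem_ofPred_eq] at hx ⊢
  obtain ⟨σ, hσ, hxσ⟩ := hx
  exact ⟨⟨translate u σ, hK σ σ.2 u hu⟩, (hf σ _ u hu rfl).ge.trans hσ,
    add_mem_translate_iff.2 hxσ⟩

/-- The projection to the torus. -/
abbrev proj {d : ℕ} (Λ : Submodule ℤ (E d)) (x : E d) : Torus Λ := Submodule.Quotient.mk x

theorem proj_eq_iff {d : ℕ} {Λ : Submodule ℤ (E d)} {x y : E d} :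
    proj Λ x = proj Λ y ↔ ∃ u ∈ Λ, y = x + u := by
  rw [eq_comm, Submodule.Quotient.eq]
  exact ⟨fun h => ⟨_, h, by abel⟩, by rintro ⟨u, hu, rfl⟩; simpa⟩

theorem continuous_proj {d : ℕ} (Λ : Submodule ℤ (E d)) : Continuous (proj Λ) :=
  Λ.isOpenQuotientMap_mkQ.continuous

/-- The sublevel sets upstairs are `Λ`-invariant, so questions about torus points can be decided on
any representative. -/
theorem proj_mem_quotientSublevel_iff {d : ℕ} {K : CellComplex d} {f : CellFilter K}
    {Λ : Submodule ℤ (E d)} (hK : K.IsPeriodic Λ) (hf : f.IsPeriodic Λ) {t : ℝ} {x : E d} :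
    proj Λ x ∈ f.quotientSublevel hf t ↔ x ∈ f.sublevel t := by
  simp only [CellFilter.quotientSublevel, Set.mem_iUnion, Set.mem_ofPred_eq]
  constructor
  · rintro ⟨c, hc, hx⟩
    induction c using Quotient.inductionOn with
    | h σ =>
      obtain ⟨y, hy, hyx⟩ := hx
      obtain ⟨u, hu, rfl⟩ := proj_eq_iff.1 hyx
      exact CellFilter.add_mem_sublevel hK hf (Set.mem_biUnion hc hy) hu
  · intro hx
    simp only [CellFilter.sublevel, Set.mem_iUnion, Set.mem_ofPred_eq] at hx
    obtain ⟨σ, hσ, hxσ⟩ := hx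
    exact ⟨Quotient.mk _ σ, hσ, x, hxσ, rfl⟩

theorem CellComplex.isConnected_cell {d : ℕ} (K : CellComplex d) (σ : K.cells) :
    IsConnected (σ : Set (E d)) := by
  have hb : IsConnected (Metric.closedBall (0 : E (K.dim σ)) 1) :=
    ⟨⟨0, by simp⟩, (convex_closedBall _ _).isPreconnected⟩
  have : ConnectedSpace (UnitBall (K.dim σ)) := isConnected_iff_connectedSpace.1 hb
  have h2 : ConnectedSpace (σ : Set (E d)) :=
    (K.chart σ).surjective.connectedSpace (K.chart σ).continuous
  exact isConnected_iff_connectedSpace.2 h2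

theorem CellComplex.isClosed_cell {d : ℕ} (K : CellComplex d) (σ : K.cells) :
    IsClosed (σ : Set (E d)) := by
  have : CompactSpace (UnitBall (K.dim σ)) :=
    isCompact_iff_compactSpace.1 (isCompact_closedBall _ _)
  have h2 : CompactSpace (σ : Set (E d)) := (K.chart σ).compactSpace
  exact (isCompact_iff_compactSpace.2 h2).isClosed

/-- The component of `x` in the sublevel set at height `t`. -/
abbrev CellFilter.comp {d : ℕ} {K : CellComplex d} (f : CellFilter K) (t : ℝ) (x : E d) :
    Set (E d) :=
  connectedComponentIn (f.sublevel t) x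

/-- The components of a sublevel set are relatively open. -/
theorem CellFilter.exists_isOpen_comp {d : ℕ} {K : CellComplex d} (f : CellFilter K) (t : ℝ)
    (x : E d) : ∃ O : Set (E d), IsOpen O ∧ f.sublevel t ∩ O = f.comp t x := by
  have hc : ∀ J : Set K.cells, IsClosed (⋃ σ : J, ((σ : K.cells) : Set (E d))) := fun J =>
    (K.locallyFinite.comp_injective (g := ((↑) : J → K.cells))
      Subtype.val_injective).isClosed_iUnion fun σ => K.isClosed_cell σ
  -- A connected cell of the sublevel set that meets the component lies inside it, so removing the
  -- cells not contained in it removes exactly the other components.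
  refine ⟨_, (hc {σ | f.val σ ≤ t ∧ ¬ (σ : Set (E d)) ⊆ f.comp t x}).isOpen_compl, ?_⟩
  ext y
  simp only [Set.mem_inter_iff, Set.mem_compl_iff, Set.mem_iUnion, not_exists]
  constructor
  · rintro ⟨hy, hy'⟩
    simp only [sublevel, Set.mem_iUnion, Set.mem_ofPred_eq] at hy
    obtain ⟨σ, hσ, hyσ⟩ := hy
    by_contra hn
    exact hy' ⟨σ, hσ, fun hsub => hn (hsub hyσ)⟩ hyσ
  · intro hy
    refine ⟨connectedComponentIn_subset _ _ hy, ?_⟩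
    rintro ⟨σ, hσ, hσ'⟩ hyσ
    apply hσ'
    rw [CellFilter.comp, connectedComponentIn_eq hy]
    exact (K.isConnected_cell σ).isPreconnected.subset_connectedComponentIn hyσ
      (Set.subset_biUnion_of_mem (u := fun σ : K.cells => (σ : Set (E d))) hσ)

theorem CellFilter.translate_sublevel {d : ℕ} {K : CellComplex d} {f : CellFilter K}
    {Λ : Submodule ℤ (E d)} (hK : K.IsPeriodic Λ) (hf : f.IsPeriodic Λ) {t : ℝ} {u : E d}
    (hu : u ∈ Λ) : translate u (f.sublevel t) = f.sublevel t := by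
  ext y
  rw [mem_translate_iff]
  refine ⟨fun h => ?_, fun h => ?_⟩
  · simpa using add_mem_sublevel hK hf h hu
  · simpa [sub_eq_add_neg] using add_mem_sublevel hK hf h (Λ.neg_mem hu)

theorem CellFilter.comp_add {d : ℕ} {K : CellComplex d} {f : CellFilter K}
    {Λ : Submodule ℤ (E d)} (hK : K.IsPeriodic Λ) (hf : f.IsPeriodic Λ) {t : ℝ} {x u : E d}
    (hx : x ∈ f.sublevel t) (hu : u ∈ Λ) : f.comp t (x + u) = translate u (f.comp t x) := by
  have := (Homeomorph.addRight u).image_connectedComponentIn hx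
  change translate u (f.comp t x) = connectedComponentIn (translate u (f.sublevel t)) (x + u) at this
  rw [this, translate_sublevel hK hf hu]

/-- The components of the sublevel sets on the torus are the projections of components. -/
theorem CellFilter.component_quotientSublevel {d : ℕ} {K : CellComplex d} {f : CellFilter K}
    {Λ : Submodule ℤ (E d)} (hK : K.IsPeriodic Λ) (hf : f.IsPeriodic Λ) {t : ℝ} {x : E d}
    (hx : x ∈ f.sublevel t) :
    connectedComponentIn (f.quotientSublevel hf t) (proj Λ x) = proj Λ '' f.comp t x := by
  have hxV := (proj_mem_quotientSublevel_iff hK hf).2 hx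
  have hsub : proj Λ '' f.comp t x ⊆ f.quotientSublevel hf t := by
    rintro _ ⟨y, hy, rfl⟩
    exact (proj_mem_quotientSublevel_iff hK hf).2 (connectedComponentIn_subset _ _ hy)
  refine subset_antisymm ?_ ((isPreconnected_connectedComponentIn.image _
    (continuous_proj Λ).continuousOn).subset_connectedComponentIn
      ⟨x, mem_connectedComponentIn hx, rfl⟩ hsub)
  choose O hO hO' using f.exists_isOpen_comp t
  have hop : IsOpenMap (proj Λ) := Λ.isOpenMap_mkQ
  have hmem : ∀ z, z ∈ f.sublevel t → ∀ y, proj Λ z ∈ proj Λ '' O y →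
      ∃ w ∈ f.comp t y, ∃ u ∈ Λ, z = w + u := by
    rintro z hz y ⟨w, hw, hwz⟩
    refine ⟨w, ?_, proj_eq_iff.1 hwz⟩
    rw [← hO' y]
    exact ⟨(proj_mem_quotientSublevel_iff hK hf).1 (by
      rw [hwz]; exact (proj_mem_quotientSublevel_iff hK hf).2 hz), hw⟩
  -- The images of `O x` and `B` are meant to separate: both are open on the torus, they cover the
  -- component, and a point outside the projected `f.comp t x` would make the component meet both.
  set B : Set (Torus Λ) := ⋃ y ∈ {y | y ∈ f.sublevel t ∧ proj Λ y ∉ proj Λ '' f.comp t x},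
    proj Λ '' O y with hB
  have hBo : IsOpen B := isOpen_biUnion fun y _ => hop _ (hO y)
  set V := f.quotientSublevel hf t
  intro p hp
  obtain ⟨z, rfl⟩ := Submodule.Quotient.mk_surjective Λ p
  by_contra hzn
  have hself : ∀ y ∈ f.sublevel t, y ∈ O y := fun y hy => by
    have := mem_connectedComponentIn hy
    change y ∈ f.comp t y at this
    rw [← hO' y] at this
    exact this.2
  have hzS : z ∈ f.sublevel t :=
    (proj_mem_quotientSublevel_iff hK hf).1 (connectedComponentIn_subset _ _ hp)
  have hcov : connectedComponentIn V (proj Λ x) ⊆ proj Λ '' O x ∪ B := by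
    intro q hq
    obtain ⟨y, rfl⟩ := Submodule.Quotient.mk_surjective Λ q
    have hy : y ∈ f.sublevel t :=
      (proj_mem_quotientSublevel_iff hK hf).1 (connectedComponentIn_subset _ _ hq)
    by_cases hyc : proj Λ y ∈ proj Λ '' f.comp t x
    · left
      rw [← hO' x] at hyc
      exact Set.image_mono Set.inter_subset_right hyc
    · right
      exact Set.mem_biUnion (x := y) ⟨hy, hyc⟩ ⟨y, hself y hy, rfl⟩
  obtain ⟨q, hqV, hqO, hqB⟩ := isPreconnected_connectedComponentIn (x := proj Λ x) (F := V)
    _ B (hop _ (hO x)) hBo hcov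
    ⟨proj Λ x, mem_connectedComponentIn hxV, x, hself x hx, rfl⟩
    ⟨proj Λ z, hp, Set.mem_biUnion (x := z) ⟨hzS, hzn⟩ ⟨z, hself z hzS, rfl⟩⟩
  simp only [hB, Set.mem_iUnion] at hqB
  obtain ⟨y, ⟨hyS, hyn⟩, hqy⟩ := hqB
  obtain ⟨r, rfl⟩ := Submodule.Quotient.mk_surjective Λ q
  have hr : r ∈ f.sublevel t :=
    (proj_mem_quotientSublevel_iff hK hf).1 (connectedComponentIn_subset _ _ hqV)
  -- A point of the component in both open sets makes the components of `x` and `y` translates of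
  -- each other by `Λ`, contrary to the choice of `y`.
  obtain ⟨w, hw, u, hu, rfl⟩ := hmem r hr x hqO
  obtain ⟨w', hw', u', hu', hww⟩ := hmem _ hr y hqy
  have hwS := connectedComponentIn_subset _ _ hw
  have e1 : f.comp t x = f.comp t w := connectedComponentIn_eq hw
  have e2 : f.comp t y = f.comp t w' := connectedComponentIn_eq hw'
  have e3 : w' = w + (u - u') := by rw [eq_sub_of_add_eq hww.symm]; abel
  have huu := Λ.sub_mem hu hu'
  have e4 : f.comp t y = translate (u - u') (f.comp t x) := by
    rw [e2, e3, comp_add hK hf hwS huu, e1]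
  have hy : y ∈ f.comp t y := mem_connectedComponentIn hyS
  rw [e4, mem_translate_iff] at hy
  exact hyn ⟨_, hy, proj_eq_iff.2 ⟨_, huu, by abel⟩⟩

/-- The shadows of a component are the translates of a component of the preimage, so the
periodicity lattice is the stabilizer of any one of them. -/
theorem CellFilter.mem_periodicityLattice_iff {d : ℕ} {K : CellComplex d} {f : CellFilter K}
    {Λ : Submodule ℤ (E d)} (hK : K.IsPeriodic Λ) (hf : f.IsPeriodic Λ) {t : ℝ} {x u : E d}
    (hx : x ∈ f.sublevel t) :
    u ∈ periodicityLattice (proj Λ '' f.comp t x) ↔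
      u ∈ Λ ∧ translate u (f.comp t x) = f.comp t x := by
  have hl : ∀ z, z ∈ lift (proj Λ '' f.comp t x) ↔ ∃ w ∈ f.comp t x, ∃ v ∈ Λ, z = w + v := by
    intro z
    constructor
    · rintro ⟨w, hw, hwz⟩
      exact ⟨w, hw, proj_eq_iff.1 hwz⟩
    · rintro ⟨w, hw, hwz⟩
      exact ⟨w, hw, proj_eq_iff.2 hwz⟩
  have hsub : lift (proj Λ '' f.comp t x) ⊆ f.sublevel t := by
    intro z hz
    obtain ⟨w, hw, v, hv, rfl⟩ := (hl z).1 hz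
    exact add_mem_sublevel hK hf (connectedComponentIn_subset _ _ hw) hv
  -- Every shadow is a `Λ`-translate of `f.comp t x`. Since translations commute, all shadows then
  -- have the same stabilizer.
  have hsh : ∀ z ∈ lift (proj Λ '' f.comp t x), ∃ v ∈ Λ,
      connectedComponentIn (lift (proj Λ '' f.comp t x)) z = translate v (f.comp t x) := by
    intro z hz
    have hzS := hsub hz
    obtain ⟨w, hw, v, hv, rfl⟩ := (hl z).1 hz
    have e : f.comp t (w + v) = translate v (f.comp t x) := by
      rw [comp_add hK hf (connectedComponentIn_subset _ _ hw) hv]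
      exact congrArg _ (connectedComponentIn_eq hw).symm
    refine ⟨v, hv, subset_antisymm ?_ ?_⟩
    · rw [← e]
      exact connectedComponentIn_mono _ hsub
    · rw [← e]
      refine isPreconnected_connectedComponentIn.subset_connectedComponentIn
        (mem_connectedComponentIn hzS) ?_
      change f.comp t (w + v) ⊆ _
      rw [e]
      rintro _ ⟨y, hy, rfl⟩
      exact (hl _).2 ⟨y, hy, v, hv, rfl⟩
  change (u ∈ Λ ∧ ∀ c ∈ shadows (proj Λ '' f.comp t x), translate u c = c) ↔ _
  refine and_congr_right fun hu => ⟨fun H => ?_, ?_⟩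
  · have hxl : x ∈ lift (proj Λ '' f.comp t x) := ⟨x, mem_connectedComponentIn hx, rfl⟩
    obtain ⟨v, hv, e⟩ := hsh x hxl
    have := H _ ⟨x, hxl, rfl⟩
    simp only [e] at this
    rw [translate_translate, add_comm, ← translate_translate] at this
    exact Set.image_injective.2 (add_left_injective v) this
  · rintro H _ ⟨z, hz, rfl⟩
    obtain ⟨v, hv, e⟩ := hsh z hz
    simp only [e]
    rw [translate_translate, add_comm, ← translate_translate, H]

/-! ### Maps of merge trees -/

/-- The map of merge trees induced by a continuous map that respects the sublevel sets. -/
def MergeTree.map {X Y : Type} [TopologicalSpace X] [TopologicalSpace Y] {S : ℝ → Set X}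
    {T : ℝ → Set Y} (g : X → Y) (hg : Continuous g) (h : ∀ t, Set.MapsTo g (S t) (T t)) :
    MergeTree S → MergeTree T :=
  Quotient.map (sa := mergeSetoid S) (sb := mergeSetoid T)
    (fun p => ⟨(g p.1.1, p.1.2), h _ p.2⟩) (by
      rintro ⟨⟨x, s⟩, hx⟩ ⟨⟨y, t⟩, hy⟩ ⟨h1, h2⟩
      obtain rfl : s = t := h1
      refine ⟨rfl, connectedComponentIn_eq (connectedComponentIn_mono _ (h s).image_subset ?_)⟩
      exact hg.continuousOn.mapsTo_connectedComponentIn hx (h2 ▸ mem_connectedComponentIn hy))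

theorem MergeTree.continuous_map {X Y : Type} [TopologicalSpace X] [TopologicalSpace Y]
    {S : ℝ → Set X} {T : ℝ → Set Y} (g : X → Y) (hg : Continuous g)
    (h : ∀ t, Set.MapsTo g (S t) (T t)) : Continuous (MergeTree.map (S := S) (T := T) g hg h) :=
  Continuous.quotient_map' (s := mergeSetoid S) (t := mergeSetoid T)
    (((hg.comp (continuous_fst.comp continuous_subtype_val)).prodMk
      (continuous_snd.comp continuous_subtype_val)).subtype_mk _) _

section Point

variable {d : ℕ} {K : CellComplex d} {f : CellFilter K} {Λ Λ' : Submodule ℤ (E d)}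

/-- The point of the periodic merge tree given by the component of `x` at height `t`. -/
def treePoint (hK : K.IsPeriodic Λ) (hf : f.IsPeriodic Λ) {t : ℝ} {x : E d}
    (hx : x ∈ f.sublevel t) : (periodicMergeTree f Λ hf).Point :=
  Quotient.mk (mergeSetoid (f.quotientSublevel hf))
    ⟨(proj Λ x, t), (proj_mem_quotientSublevel_iff hK hf).2 hx⟩

theorem exists_eq_treePoint (hK : K.IsPeriodic Λ) (hf : f.IsPeriodic Λ)
    (a : (periodicMergeTree f Λ hf).Point) :
    ∃ (t : ℝ) (x : E d) (hx : x ∈ f.sublevel t), a = treePoint hK hf hx := by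
  obtain ⟨⟨⟨p, t⟩, hp⟩, rfl⟩ := Quotient.exists_rep (s := mergeSetoid (f.quotientSublevel hf)) a
  obtain ⟨x, rfl⟩ := Submodule.Quotient.mk_surjective Λ p
  exact ⟨t, x, (proj_mem_quotientSublevel_iff hK hf).1 hp, rfl⟩

theorem component_treePoint (hK : K.IsPeriodic Λ) (hf : f.IsPeriodic Λ) {t : ℝ} {x : E d}
    (hx : x ∈ f.sublevel t) :
    (periodicMergeTree f Λ hf).component (treePoint hK hf hx) = proj Λ '' f.comp t x :=
  CellFilter.component_quotientSublevel hK hf hx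

theorem frequency_treePoint (hK : K.IsPeriodic Λ) (hf : f.IsPeriodic Λ) {t : ℝ} {x : E d}
    (hx : x ∈ f.sublevel t) :
    (periodicMergeTree f Λ hf).frequency (treePoint hK hf hx) =
      shadowMonomial (proj Λ '' f.comp t x) :=
  congrArg shadowMonomial (component_treePoint hK hf hx)

theorem image_translate {u : E d} (A : Set (E d)) :
    proj Λ '' translate u A = (fun p => p + proj Λ u) '' (proj Λ '' A) := by
  rw [translate, Set.image_image, Set.image_image]
  rfl

theorem image_translate_of_mem {u : E d} (hu : u ∈ Λ) (A : Set (E d)) :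
    proj Λ '' translate u A = proj Λ '' A := by
  rw [image_translate, show proj Λ u = 0 from (Submodule.Quotient.mk_eq_zero Λ).2 hu]
  simp

theorem image_comp_eq_iff (hK : K.IsPeriodic Λ) (hf : f.IsPeriodic Λ) {t : ℝ} {x y : E d}
    (hy : y ∈ f.sublevel t) :
    proj Λ '' f.comp t x = proj Λ '' f.comp t y ↔
      ∃ u ∈ Λ, f.comp t y = translate u (f.comp t x) := by
  constructor
  · intro h
    obtain ⟨w, hw, hwy⟩ : proj Λ y ∈ proj Λ '' f.comp t x :=
      h ▸ ⟨y, mem_connectedComponentIn hy, rfl⟩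
    obtain ⟨u, hu, rfl⟩ := proj_eq_iff.1 hwy
    refine ⟨u, hu, ?_⟩
    rw [CellFilter.comp_add hK hf (connectedComponentIn_subset _ _ hw) hu]
    exact congrArg _ (connectedComponentIn_eq hw).symm
  · rintro ⟨u, hu, h⟩
    rw [h, image_translate_of_mem hu]

theorem treePoint_eq_iff (hK : K.IsPeriodic Λ) (hf : f.IsPeriodic Λ) {t : ℝ} {x y : E d}
    (hx : x ∈ f.sublevel t) (hy : y ∈ f.sublevel t) :
    treePoint hK hf hx = treePoint hK hf hy ↔
      ∃ u ∈ Λ, f.comp t y = translate u (f.comp t x) := by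
  rw [← image_comp_eq_iff hK hf hy, ← CellFilter.component_quotientSublevel hK hf hx,
    ← CellFilter.component_quotientSublevel hK hf hy]
  exact Quotient.eq.trans (and_iff_right rfl)

theorem periodicityLattice_le (C : Set (Torus Λ)) : periodicityLattice C ≤ Λ := fun _ hu => hu.1

theorem translate_injective (u : E d) : Function.Injective (translate u) :=
  Set.image_injective.2 (add_left_injective u)

/-- The component upstairs does not depend on the lattice; only the supply of admissible
translations changes. -/
theorem periodicityLattice_inf (hK : K.IsPeriodic Λ) (hf : f.IsPeriodic Λ) (h : Λ' ≤ Λ) {t : ℝ}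
    {x : E d} (hx : x ∈ f.sublevel t) :
    periodicityLattice (proj Λ' '' f.comp t x) =
      Λ' ⊓ periodicityLattice (proj Λ '' f.comp t x) := by
  ext u
  rw [Submodule.mem_inf, CellFilter.mem_periodicityLattice_iff hK hf hx,
    CellFilter.mem_periodicityLattice_iff (hK.mono h) (hf.mono h) hx]
  exact ⟨fun H => ⟨H.1, h H.1, H.2⟩, fun H => ⟨H.1, H.2.2⟩⟩

theorem periodicityLattice_add (hK : K.IsPeriodic Λ) (hf : f.IsPeriodic Λ) (h : Λ' ≤ Λ) {t : ℝ}
    {x u : E d} (hx : x ∈ f.sublevel t) (hu : u ∈ Λ) :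
    periodicityLattice (proj Λ' '' f.comp t (x + u)) =
      periodicityLattice (proj Λ' '' f.comp t x) := by
  ext v
  rw [CellFilter.mem_periodicityLattice_iff (hK.mono h) (hf.mono h) hx,
    CellFilter.mem_periodicityLattice_iff (hK.mono h) (hf.mono h)
      (CellFilter.add_mem_sublevel hK hf hx hu), CellFilter.comp_add hK hf hx hu,
    translate_translate, add_comm u v, ← translate_translate, (translate_injective u).eq_iff]

/-! ### The splintering map -/

/-- The covering map between the tori of a lattice and a sublattice. -/
abbrev torusMap (h : Λ' ≤ Λ) : Torus Λ' → Torus Λ := Submodule.factor h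

theorem continuous_torusMap (h : Λ' ≤ Λ) : Continuous (torusMap h) :=
  Λ'.isOpenQuotientMap_mkQ.isQuotientMap.continuous_iff.2 (continuous_proj Λ)

/-- The map between periodic merge trees induced by the covering map of the tori. -/
def splinterMap (hK : K.IsPeriodic Λ) (hf : f.IsPeriodic Λ) (h : Λ' ≤ Λ) :
    (periodicMergeTree f Λ' (hf.mono h)).Point → (periodicMergeTree f Λ hf).Point :=
  MergeTree.map (torusMap h) (continuous_torusMap h) (by
    intro t p hp
    obtain ⟨x, rfl⟩ := Submodule.Quotient.mk_surjective Λ' p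
    exact (proj_mem_quotientSublevel_iff hK hf).2
      ((proj_mem_quotientSublevel_iff (hK.mono h) (hf.mono h)).1 hp))

theorem splinterMap_treePoint (hK : K.IsPeriodic Λ) (hf : f.IsPeriodic Λ) (h : Λ' ≤ Λ) {t : ℝ}
    {x : E d} (hx : x ∈ f.sublevel t) :
    splinterMap hK hf h (treePoint (hK.mono h) (hf.mono h) hx) = treePoint hK hf hx := rfl

theorem component_splinterMap (hK : K.IsPeriodic Λ) (hf : f.IsPeriodic Λ) (h : Λ' ≤ Λ)
    (a : (periodicMergeTree f Λ' (hf.mono h)).Point) :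
    (periodicMergeTree f Λ hf).component (splinterMap hK hf h a) =
      torusMap h '' (periodicMergeTree f Λ' (hf.mono h)).component a := by
  obtain ⟨t, x, hx, rfl⟩ := exists_eq_treePoint (hK.mono h) (hf.mono h) a
  rw [splinterMap_treePoint, component_treePoint, component_treePoint, Set.image_image]
  rfl

theorem height_splinterMap (hK : K.IsPeriodic Λ) (hf : f.IsPeriodic Λ) (h : Λ' ≤ Λ)
    (a : (periodicMergeTree f Λ' (hf.mono h)).Point) :
    (periodicMergeTree f Λ hf).height (splinterMap hK hf h a) =
      (periodicMergeTree f Λ' (hf.mono h)).height a := by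
  obtain ⟨t, x, hx, rfl⟩ := exists_eq_treePoint (hK.mono h) (hf.mono h) a
  rfl

/-- The action of `Λ` on the periodic merge tree of a sublattice `Λ'`. -/
def shift (hK : K.IsPeriodic Λ) (hf : f.IsPeriodic Λ) (h : Λ' ≤ Λ) {u : E d} (hu : u ∈ Λ) :
    (periodicMergeTree f Λ' (hf.mono h)).Point → (periodicMergeTree f Λ' (hf.mono h)).Point :=
  MergeTree.map (fun p => p + proj Λ' u) (continuous_add_const _) (by
    intro t p hp
    obtain ⟨x, rfl⟩ := Submodule.Quotient.mk_surjective Λ' p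
    exact (proj_mem_quotientSublevel_iff (hK.mono h) (hf.mono h)).2
      (CellFilter.add_mem_sublevel hK hf
        ((proj_mem_quotientSublevel_iff (hK.mono h) (hf.mono h)).1 hp) hu))

theorem shift_treePoint (hK : K.IsPeriodic Λ) (hf : f.IsPeriodic Λ) (h : Λ' ≤ Λ) {u : E d}
    (hu : u ∈ Λ) {t : ℝ} {x : E d} (hx : x ∈ f.sublevel t) :
    shift hK hf h hu (treePoint (hK.mono h) (hf.mono h) hx) =
      treePoint (hK.mono h) (hf.mono h) (CellFilter.add_mem_sublevel hK hf hx hu) := rfl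

theorem continuous_shift (hK : K.IsPeriodic Λ) (hf : f.IsPeriodic Λ) (h : Λ' ≤ Λ) {u : E d}
    (hu : u ∈ Λ) : Continuous (shift hK hf h hu) :=
  MergeTree.continuous_map _ _ _

theorem height_shift (hK : K.IsPeriodic Λ) (hf : f.IsPeriodic Λ) (h : Λ' ≤ Λ) {u : E d}
    (hu : u ∈ Λ) (a : (periodicMergeTree f Λ' (hf.mono h)).Point) :
    (periodicMergeTree f Λ' (hf.mono h)).height (shift hK hf h hu a) =
      (periodicMergeTree f Λ' (hf.mono h)).height a := by
  obtain ⟨t, x, hx, rfl⟩ := exists_eq_treePoint (hK.mono h) (hf.mono h) a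
  rfl

theorem component_shift (hK : K.IsPeriodic Λ) (hf : f.IsPeriodic Λ) (h : Λ' ≤ Λ) {u : E d}
    (hu : u ∈ Λ) (a : (periodicMergeTree f Λ' (hf.mono h)).Point) :
    (periodicMergeTree f Λ' (hf.mono h)).component (shift hK hf h hu a) =
      (fun p => p + proj Λ' u) '' (periodicMergeTree f Λ' (hf.mono h)).component a := by
  obtain ⟨t, x, hx, rfl⟩ := exists_eq_treePoint (hK.mono h) (hf.mono h) a
  rw [shift_treePoint, component_treePoint, component_treePoint, CellFilter.comp_add hK hf hx hu,
    image_translate]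

theorem frequency_shift (hK : K.IsPeriodic Λ) (hf : f.IsPeriodic Λ) (h : Λ' ≤ Λ) {u : E d}
    (hu : u ∈ Λ) (a : (periodicMergeTree f Λ' (hf.mono h)).Point) :
    (periodicMergeTree f Λ' (hf.mono h)).frequency (shift hK hf h hu a) =
      (periodicMergeTree f Λ' (hf.mono h)).frequency a := by
  obtain ⟨t, x, hx, rfl⟩ := exists_eq_treePoint (hK.mono h) (hf.mono h) a
  rw [shift_treePoint, frequency_treePoint, frequency_treePoint, shadowMonomial, shadowMonomial,
    periodicityLattice_add hK hf h hx hu]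

theorem covers_shift (hK : K.IsPeriodic Λ) (hf : f.IsPeriodic Λ) (h : Λ' ≤ Λ) {u : E d}
    (hu : u ∈ Λ) {a b : (periodicMergeTree f Λ' (hf.mono h)).Point}
    (hab : (periodicMergeTree f Λ' (hf.mono h)).Covers a b) :
    (periodicMergeTree f Λ' (hf.mono h)).Covers (shift hK hf h hu a) (shift hK hf h hu b) := by
  refine ⟨?_, ?_⟩
  · rw [height_shift, height_shift]
    exact hab.1
  · rw [component_shift, component_shift]
    exact Set.image_mono hab.2

theorem shift_shift_of_add_eq_zero (hK : K.IsPeriodic Λ) (hf : f.IsPeriodic Λ) (h : Λ' ≤ Λ)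
    {u v : E d} (hu : u ∈ Λ) (hv : v ∈ Λ) (huv : u + v = 0)
    (a : (periodicMergeTree f Λ' (hf.mono h)).Point) :
    shift hK hf h hv (shift hK hf h hu a) = a := by
  obtain ⟨t, x, hx, rfl⟩ := exists_eq_treePoint (hK.mono h) (hf.mono h) a
  rw [shift_treePoint, shift_treePoint]
  congr 1
  rw [add_assoc, huv, add_zero]

theorem splinterMap_shift (hK : K.IsPeriodic Λ) (hf : f.IsPeriodic Λ) (h : Λ' ≤ Λ)
    {u : E d} (hu : u ∈ Λ) (a : (periodicMergeTree f Λ' (hf.mono h)).Point) :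
    splinterMap hK hf h (shift hK hf h hu a) = splinterMap hK hf h a := by
  obtain ⟨t, x, hx, rfl⟩ := exists_eq_treePoint (hK.mono h) (hf.mono h) a
  rw [shift_treePoint, splinterMap_treePoint, splinterMap_treePoint]
  refine (treePoint_eq_iff hK hf _ _).2 ⟨-u, Λ.neg_mem hu, ?_⟩
  rw [CellFilter.comp_add hK hf hx hu, translate_translate, add_neg_cancel, translate_zero]

/-- The fibers of the splintering map are the orbits of `Λ`. -/
theorem splinterMap_eq_iff (hK : K.IsPeriodic Λ) (hf : f.IsPeriodic Λ) (h : Λ' ≤ Λ)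
    (a b : (periodicMergeTree f Λ' (hf.mono h)).Point) :
    splinterMap hK hf h a = splinterMap hK hf h b ↔
      ∃ (u : E d) (hu : u ∈ Λ), b = shift hK hf h hu a := by
  refine ⟨fun H => ?_, ?_⟩
  · have hh := height_splinterMap hK hf h a
    rw [H, height_splinterMap] at hh
    obtain ⟨t, x, hx, rfl⟩ := exists_eq_treePoint (hK.mono h) (hf.mono h) a
    obtain ⟨s, y, hy, rfl⟩ := exists_eq_treePoint (hK.mono h) (hf.mono h) b
    obtain rfl : s = t := hh
    rw [splinterMap_treePoint, splinterMap_treePoint, treePoint_eq_iff] at H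
    obtain ⟨u, hu, e⟩ := H
    refine ⟨u, hu, ?_⟩
    rw [shift_treePoint, treePoint_eq_iff]
    -- After the shift by `u` the components upstairs already coincide, so no further translation in
    -- `Λ'` is needed.
    refine ⟨0, Λ'.zero_mem, ?_⟩
    rw [e, translate_zero, CellFilter.comp_add hK hf hx hu]
  · rintro ⟨u, hu, rfl⟩
    exact (splinterMap_shift hK hf h hu a).symm

/-- This computes the stabilizer: a translation fixes the point exactly when a correction by `Λ'`
makes it fix the component upstairs. The form `-u + v` is that of left cosets. -/
theorem shift_treePoint_eq_iff (hK : K.IsPeriodic Λ) (hf : f.IsPeriodic Λ) (h : Λ' ≤ Λ)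
    {u v : E d} (hu : u ∈ Λ) (hv : v ∈ Λ) {t : ℝ} {x : E d} (hx : x ∈ f.sublevel t) :
    shift hK hf h hu (treePoint (hK.mono h) (hf.mono h) hx) =
      shift hK hf h hv (treePoint (hK.mono h) (hf.mono h) hx) ↔
    -u + v ∈ Λ'.toAddSubgroup ⊔ (periodicityLattice (proj Λ '' f.comp t x)).toAddSubgroup := by
  rw [shift_treePoint, shift_treePoint, treePoint_eq_iff, CellFilter.comp_add hK hf hx hu,
    CellFilter.comp_add hK hf hx hv, AddSubgroup.mem_sup]
  constructor
  · rintro ⟨w, hw, e⟩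
    refine ⟨w, hw, -u + v - w, ?_, by abel⟩
    refine (CellFilter.mem_periodicityLattice_iff hK hf hx).2
      ⟨Λ.sub_mem (Λ.add_mem (Λ.neg_mem hu) hv) (h hw), translate_injective (u + w) ?_⟩
    rw [translate_translate, ← translate_translate u w, ← e]
    congr 1
    abel
  · rintro ⟨w, hw, l, hl, e⟩
    have hl' := ((CellFilter.mem_periodicityLattice_iff hK hf hx).1 hl).2
    refine ⟨w, hw, ?_⟩
    have hv' : v = l + (u + w) := by
      rw [← add_neg_cancel_left u v, ← e]
      abel
    rw [hv', ← translate_translate l, hl', translate_translate]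

end Point

/-- The fibers of `g` are the left cosets of `H`. No finiteness is needed, because `ncard` and
`index` are both 0 in the infinite case. -/
theorem ncard_range_eq_index {G α : Type*} [AddGroup G] (H : AddSubgroup G) (g : G → α)
    (hg : ∀ u v, g u = g v ↔ -u + v ∈ H) : (Set.range g).ncard = H.index := by
  have e : Quotient (Setoid.ker g) ≃ G ⧸ H := Quotient.congrRight fun u v => by
    rw [Setoid.ker_def, hg]
    exact (QuotientAddGroup.leftRel_apply).symm
  rw [← Nat.card_coe_set_eq, ← Nat.card_congr (Setoid.quotientKerEquivRange g), Nat.card_congr e]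
  rfl

/-! ### Fiber sizes, frequencies and subtrees -/

section Splintering

variable {d : ℕ} {K : CellComplex d} {f : CellFilter K} {Λ Λ' : Submodule ℤ (E d)}

theorem ncard_fiber_splinterMap (hK : K.IsPeriodic Λ) (hf : f.IsPeriodic Λ) (h : Λ' ≤ Λ) {t : ℝ}
    {x : E d} (hx : x ∈ f.sublevel t) :
    (splinterMap hK hf h ⁻¹' {treePoint hK hf hx}).ncard = (Λ'.toAddSubgroup ⊔
      (periodicityLattice (proj Λ '' f.comp t x)).toAddSubgroup).relIndex Λ.toAddSubgroup := by
  have : splinterMap hK hf h ⁻¹' {treePoint hK hf hx} = Set.range fun u : Λ.toAddSubgroup =>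
      shift hK hf h u.2 (treePoint (hK.mono h) (hf.mono h) hx) := by
    ext a
    rw [Set.mem_preimage, Set.mem_singleton_iff, eq_comm, ← splinterMap_treePoint hK hf h,
      splinterMap_eq_iff]
    exact ⟨fun ⟨u, hu, e⟩ => ⟨⟨u, hu⟩, e.symm⟩, fun ⟨u, e⟩ => ⟨u, u.2, e.symm⟩⟩
  rw [this]
  exact ncard_range_eq_index _ _ fun u v => shift_treePoint_eq_iff hK hf h u.2 v.2 hx

theorem finite_fiber_splinterMap [DiscreteTopology Λ] [IsZLattice ℝ Λ] [DiscreteTopology Λ']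
    [IsZLattice ℝ Λ'] (hK : K.IsPeriodic Λ) (hf : f.IsPeriodic Λ) (h : Λ' ≤ Λ)
    (c : (periodicMergeTree f Λ hf).Point) : (splinterMap hK hf h ⁻¹' {c}).Finite := by
  obtain ⟨t, x, hx, rfl⟩ := exists_eq_treePoint hK hf c
  refine Set.finite_of_ncard_ne_zero ?_
  rw [ncard_fiber_splinterMap]
  -- The stabilizer contains `Λ'`, which has finite index in `Λ`.
  exact fun h0 => relIndex_ne_zero_of_isZLattice h
    (AddSubgroup.relIndex_eq_zero_of_le_left le_sup_left h0)

theorem frequency_splinterMap [DiscreteTopology Λ] [IsZLattice ℝ Λ] [DiscreteTopology Λ']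
    [IsZLattice ℝ Λ'] (hK : K.IsPeriodic Λ) (hf : f.IsPeriodic Λ) (h : Λ' ≤ Λ)
    (a : (periodicMergeTree f Λ' (hf.mono h)).Point) :
    (periodicMergeTree f Λ' (hf.mono h)).frequency a =
      ((periodicMergeTree f Λ hf).frequency (splinterMap hK hf h a)).divNat
        (splinterMap hK hf h ⁻¹' {splinterMap hK hf h a}).ncard := by
  obtain ⟨t, x, hx, rfl⟩ := exists_eq_treePoint (hK.mono h) (hf.mono h) a
  rw [splinterMap_treePoint, ncard_fiber_splinterMap, frequency_treePoint, frequency_treePoint]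
  obtain ⟨h1, h2⟩ := latticeVolume_inf_div h (periodicityLattice_le (proj Λ '' f.comp t x))
  rw [shadowMonomial, shadowMonomial, periodicityLattice_inf hK hf h hx, RMonomial.divNat, h1, h2]
  exact RMonomial.ext (div_mul_eq_mul_div _ _ _) rfl

/-- The shifts by `u` and `-u` restrict to mutually inverse maps of the two subtrees that preserve
all data, so they are compatible already for `ε = 0`. -/
theorem interleavingDist_subtree_shift (hK : K.IsPeriodic Λ) (hf : f.IsPeriodic Λ) (h : Λ' ≤ Λ)
    {u : E d} (hu : u ∈ Λ) (a : (periodicMergeTree f Λ' (hf.mono h)).Point) :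
    interleavingDist ((periodicMergeTree f Λ' (hf.mono h)).subtree a)
      ((periodicMergeTree f Λ' (hf.mono h)).subtree (shift hK hf h hu a)) = 0 := by
  have hn := Λ.neg_mem hu
  have e1 := shift_shift_of_add_eq_zero hK hf h hu hn (add_neg_cancel u)
  have e2 := shift_shift_of_add_eq_zero hK hf h hn hu (neg_add_cancel u)
  let φ : ((periodicMergeTree f Λ' (hf.mono h)).subtree a).Point →
      ((periodicMergeTree f Λ' (hf.mono h)).subtree (shift hK hf h hu a)).Point :=
    fun p => ⟨shift hK hf h hu p.1, covers_shift hK hf h hu p.2⟩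
  let ψ : ((periodicMergeTree f Λ' (hf.mono h)).subtree (shift hK hf h hu a)).Point →
      ((periodicMergeTree f Λ' (hf.mono h)).subtree a).Point :=
    fun p => ⟨shift hK hf h hn p.1, by
      have := covers_shift hK hf h hn p.2
      rwa [e1] at this⟩
  have hψφ : ∀ p, ψ (φ p) = p := fun p => Subtype.ext (e1 p.1)
  have hφψ : ∀ p, φ (ψ p) = p := fun p => Subtype.ext (e2 p.1)
  have hle : ∀ m : RMonomial, m ≤ m := fun m => Or.inr ⟨rfl, le_rfl⟩
  refine le_antisymm (iInf₂_le_of_le 0 ⟨φ, ψ, ?_⟩ (by simp)) bot_le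
  refine ⟨?_, ?_, ?_, ?_, ?_, ?_, ?_, ?_⟩
  · exact ((continuous_shift hK hf h hu).comp continuous_subtype_val).subtype_mk _
  · exact ((continuous_shift hK hf h hn).comp continuous_subtype_val).subtype_mk _
  · intro p
    rw [NNReal.coe_zero, add_zero]
    exact height_shift hK hf h hu p.1
  · intro p
    rw [NNReal.coe_zero, add_zero]
    exact height_shift hK hf h hn p.1
  · intro p
    rw [hψφ]
    exact ⟨le_rfl, subset_rfl⟩
  · intro p
    rw [hφψ]
    exact ⟨le_rfl, subset_rfl⟩
  · intro p
    exact (frequency_shift hK hf h hu p.1).symm ▸ hle _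
  · intro p
    exact (frequency_shift hK hf h hn p.1).symm ▸ hle _

theorem surjective_splinterMap (hK : K.IsPeriodic Λ) (hf : f.IsPeriodic Λ) (h : Λ' ≤ Λ) :
    Function.Surjective (splinterMap hK hf h) := by
  intro c
  obtain ⟨t, x, hx, rfl⟩ := exists_eq_treePoint hK hf c
  exact ⟨_, splinterMap_treePoint hK hf h hx⟩

theorem image_splinterMap_covers (hK : K.IsPeriodic Λ) (hf : f.IsPeriodic Λ) (h : Λ' ≤ Λ)
    (a : (periodicMergeTree f Λ' (hf.mono h)).Point) :
    splinterMap hK hf h '' {b | (periodicMergeTree f Λ' (hf.mono h)).Covers a b} =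
      {b | (periodicMergeTree f Λ hf).Covers (splinterMap hK hf h a) b} := by
  ext b
  constructor
  · rintro ⟨b, ⟨hb1, hb2⟩, rfl⟩
    refine ⟨?_, ?_⟩
    · rwa [height_splinterMap, height_splinterMap]
    · rw [component_splinterMap, component_splinterMap]
      exact Set.image_mono hb2
  · obtain ⟨t, x, hx, rfl⟩ := exists_eq_treePoint (hK.mono h) (hf.mono h) a
    obtain ⟨s, y, hy, rfl⟩ := exists_eq_treePoint hK hf b
    rintro ⟨hst, hsub⟩
    change s ≤ t at hst
    rw [splinterMap_treePoint, component_treePoint, component_treePoint] at hsub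
    obtain ⟨w, hw, hwy⟩ := hsub ⟨y, mem_connectedComponentIn hy, rfl⟩
    obtain ⟨u, hu, rfl⟩ := proj_eq_iff.1 hwy.symm
    -- The obvious lift of `b` may lie below another point of the fiber; the shift by `u` moves `y`
    -- into the component of `x` without changing the image under `ω`.
    refine ⟨shift hK hf h hu (treePoint (hK.mono h) (hf.mono h) hy), ⟨hst, ?_⟩, ?_⟩
    · rw [shift_treePoint, component_treePoint, component_treePoint]
      refine Set.image_mono ?_
      rw [show f.comp t x = f.comp t (y + u) from connectedComponentIn_eq hw]
      exact connectedComponentIn_mono _ (f.sublevel_mono hst)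
    · rw [splinterMap_shift, splinterMap_treePoint]

end Splintering

end PeriodicMerge

end

open PeriodicMerge
theorem mainTheorem2 (d : ℕ) (Λ Λ' : Submodule ℤ (E d))
    [DiscreteTopology Λ] [IsZLattice ℝ Λ] [DiscreteTopology Λ'] [IsZLattice ℝ Λ']
    (h : Λ' ≤ Λ) (K : CellComplex d) (hK : K.IsPeriodic Λ)
    (f : CellFilter K) (hf : f.IsPeriodic Λ) :
    Splinters (periodicMergeTree f Λ' (hf.mono h)) (periodicMergeTree f Λ hf) := by
  refine ⟨splinterMap hK hf h, MergeTree.continuous_map _ _ _, surjective_splinterMap hK hf h,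
    height_splinterMap hK hf h, finite_fiber_splinterMap hK hf h, ?_, ?_, ?_⟩
  · rintro c a rfl b hb
    obtain ⟨u, hu, rfl⟩ := (splinterMap_eq_iff hK hf h a b).1 (Eq.symm hb)
    exact interleavingDist_subtree_shift hK hf h hu a
  · rintro c a rfl
    exact image_splinterMap_covers hK hf h a
  · rintro c a rfl
    exact frequency_splinterMap hK hf h a
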